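/- Let $2^{<\omega}$ be the set of finite binary strings and $2^\omega$ the set of infinite binary sequences. A prefix-free machine is a partial computable function $M:2^{<\omega}\to 2^{<\omega}$ whose domain contains no two strings one of which is a proper prefix of the other. Let $U$ be a universal prefix-free machine, that is, for some computable listing $(M_e)_{e\in\omega}$ of all prefix-free machines, $U(0^e1\sigma)=M_e(\sigma)$ for all $e\in\omega$ and $\sigma\in\mathrm{dom}(M_e)$, and $U$ is undefined on all other strings. For an integer $k\ge 1$ let $\ell_k(\sigma)=\#_0(\sigma)+k\,\#_1(\sigma)$, where $\#_i(\sigma)$ is the number of occurrences of $i$ in $\sigma$, and put $$K(\sigma)=\min\{|\tau|: U(\tau)=\sigma\},\qquad K^{(k)}(\sigma)=\min\{\ell_k(\tau): U(\tau)=\sigma\}.$$ For $X\in 2^\omega$ let $X{\upharpoonright} n$ be the string of the first $n$ bits of $X$. The sequence $X$ is called $(k,j)$-incompressible if there is a constant $d$ such that $K^{(k)}(X{\upharpoonright} n)\ge \ell_j(X{\upharpoonright} n)-d$ for all $n$. It is called complex if there is a computable, non-decreasing, unbounded function $f:\omega\to\omega$ such that $K(X{\upharpoonright} n)\ge f(n)$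 for all $n$. Theorem. Let $k\ge j\ge 1$ be integers. Then every $(k,j)$-incompressible sequence $X\in 2^\omega$ is complex. -/

import Mathlib

namespace KLength

/-- Finite binary strings; `false` is the symbol 0 and `true` is the symbol 1. -/
abbrev BinStr : Type := List Bool

/-- A set of strings is prefix-free if no element of it properly extends another one. -/
def PrefixFree (S : Set BinStr) : Prop :=
  ∀ σ ∈ S, ∀ τ ∈ S, σ <+: τ → σ = τ

/-- A prefix-free machine: a partial computable function on strings with prefix-free domain. -/
def IsPrefixFreeMachine (M : BinStr →. BinStr) : Prop :=
  Partrec M ∧ PrefixFree M.Dom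

/-- A computable listing of all (and only the) prefix-free machines. -/
def IsPrefixFreeListing (M : ℕ → BinStr →. BinStr) : Prop :=
  Partrec₂ M ∧ (∀ e, IsPrefixFreeMachine (M e)) ∧
    ∀ N : BinStr →. BinStr, IsPrefixFreeMachine N → ∃ e, M e = N

/-- `U` is a universal prefix-free machine: for some computable listing `(M e)` of all prefix-free
machines, `U (0^e 1 σ) = M e σ` for all `e` and `σ ∈ dom (M e)`, and `U` is undefined on all
other inputs. -/
def IsUniversalMachine (U : BinStr →. BinStr) : Prop :=
  ∃ M : ℕ → BinStr →. BinStr, IsPrefixFreeListing M ∧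
    ∀ τ ρ : BinStr, ρ ∈ U τ ↔
      ∃ (e : ℕ) (σ : BinStr), τ = List.replicate e false ++ true :: σ ∧ ρ ∈ M e σ

/-- The complexity `min {ℓ τ : M τ = σ}` of `σ` relative to the machine `M` and the length
function `ℓ` (the value is `⊤` exactly when `σ` is not an output of `M`). -/
noncomputable def complexity (ℓ : BinStr → ℕ) (M : BinStr →. BinStr) (σ : BinStr) : ℕ∞ :=
  ⨅ τ ∈ {τ : BinStr | σ ∈ M τ}, (ℓ τ : ℕ∞)

/-- The `k`-length: the number of zeros plus `k` times the number of ones. -/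
def kLength (k : ℕ) (σ : BinStr) : ℕ :=
  σ.count false + k * σ.count true

/-- Prefix-free Kolmogorov complexity with respect to the universal machine `U`. -/
noncomputable def K (U : BinStr →. BinStr) (σ : BinStr) : ℕ∞ :=
  complexity List.length U σ

/-- The `k`-complexity with respect to the universal machine `U`. -/
noncomputable def kComplexity (U : BinStr →. BinStr) (k : ℕ) (σ : BinStr) : ℕ∞ :=
  complexity (kLength k) U σ

/-- The string consisting of the first `n` bits of `X`. -/
def initSeg (X : ℕ → Bool) (n : ℕ) : BinStr :=
  (List.range n).map X

/-- `X` is `(k, j)`-incompressible: the `k`-complexity of each initial segment is at least its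
`j`-length minus a constant. -/
def IsIncompressible (U : BinStr →. BinStr) (k j : ℕ) (X : ℕ → Bool) : Prop :=
  ∃ d : ℕ, ∀ n : ℕ, (kLength j (initSeg X n) : ℕ∞) ≤ kComplexity U k (initSeg X n) + d

/-- A computable order: a computable, non-decreasing, unbounded function. -/
def IsComputableOrder (f : ℕ → ℕ) : Prop :=
  Computable f ∧ Monotone f ∧ ∀ b : ℕ, ∃ n : ℕ, b ≤ f n

/-- `X` is complex: `K` on the initial segments of `X` is bounded below by a computable order. -/
def IsComplex (U : BinStr →. BinStr) (X : ℕ → Bool) : Prop :=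
  ∃ f : ℕ → ℕ, IsComputableOrder f ∧ ∀ n : ℕ, (f n : ℕ∞) ≤ K U (initSeg X n)

end KLength

namespace KLength

/-! Each bit of a description costs at most `k`, so `K^(k) ≤ k * K`; each bit of `X↾n` counts at
least 1 in `ℓ_j`. Incompressibility thus gives `n ≤ k * K(X↾n) + d`, and the linear order `(n - d) /
k` bounds `K(X↾n)` from below. -/

theorem length_le_kLength {j : ℕ} (hj : 1 ≤ j) (σ : BinStr) : σ.length ≤ kLength j σ := by
  have h := List.count_false_add_count_true σ
  have := Nat.mul_le_mul_right (σ.count true) hj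
  unfold kLength
  omega

theorem kLength_le_mul_length {k : ℕ} (hk : 1 ≤ k) (σ : BinStr) :
    kLength k σ ≤ k * σ.length := by
  have h := List.count_false_add_count_true σ
  have := Nat.mul_le_mul_right (σ.count false) hk
  rw [← h, mul_add]
  unfold kLength
  omega

theorem length_initSeg (X : ℕ → Bool) (n : ℕ) : (initSeg X n).length = n := by
  simp [initSeg]

/-- A description of `σ` of length `m` bounds the `k`-complexity of `σ` by `k * m`. -/
theorem complexity_kLength_le {M : BinStr →. BinStr} {k : ℕ} (hk : 1 ≤ k) {σ τ : BinStr}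
    (h : σ ∈ M τ) : complexity (kLength k) M σ ≤ ((k * τ.length : ℕ) : ℕ∞) :=
  (iInf₂_le τ h).trans (by exact_mod_cast kLength_le_mul_length hk τ)

theorem isComputableOrder_sub_div (d : ℕ) {k : ℕ} (hk : 1 ≤ k) :
    IsComputableOrder fun n => (n - d) / k := by
  refine ⟨?_, fun a b h => Nat.div_le_div_right (Nat.sub_le_sub_right h d),
    fun b => ⟨b * k + d, ?_⟩⟩
  · exact (Primrec.nat_div.comp (Primrec.nat_sub.comp .id (.const d)) (.const k)).to_comp
  · simp [Nat.mul_div_cancel b hk]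

end KLength

theorem mainTheorem7 (U : KLength.BinStr →. KLength.BinStr) (hU : KLength.IsUniversalMachine U)
    (k j : ℕ) (hj : 1 ≤ j) (hjk : j ≤ k) (X : ℕ → Bool)
    (hX : KLength.IsIncompressible U k j X) : KLength.IsComplex U X := by
  have hk : 1 ≤ k := hj.trans hjk
  obtain ⟨d, hd⟩ := hX
  -- The infimum is bounded one description `τ` at a time, so finiteness of `K` is never needed.
  refine ⟨_, KLength.isComputableOrder_sub_div d hk, fun n => le_iInf₂ fun τ hτ => ?_⟩
  have h₁ := KLength.length_le_kLength hj (KLength.initSeg X n)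
  rw [KLength.length_initSeg] at h₁
  have h₂ : KLength.kLength j (KLength.initSeg X n) ≤ k * τ.length + d := by
    exact_mod_cast (hd n).trans (add_le_add_left (KLength.complexity_kLength_le hk hτ) (d : ℕ∞))
  -- Truncated subtraction is harmless: for `n < d` the left side is 0.
  have h₃ : (n - d) / k ≤ τ.length := Nat.div_le_of_le_mul (by omega)
  exact_mod_cast h₃
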